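/- Let $B$ be a complete separable metric space. An mm-field over $B$ is a quadruple $\mathcal X=(X,d_X,\pi_X,\mu_X)$, where $(X,d_X)$ is a complete separable metric space, $\pi_X\colon X\to B$ is $1$-Lipschitz and $\mu_X$ is a Borel probability measure on $X$; it is bounded if $(X,d_X)$ has finite diameter. For measures $\alpha,\beta$, let $C(\alpha,\beta)$ be the set of their couplings (measures on the product with marginals $\alpha$ and $\beta$). For $N\in\{0,1,2,\dots\}\cup\{\infty\}$, let $\mathcal R_B^N$ be the space of pairs $((r_{ij})_{i,j},(b_i)_i)$, the indices ranging over the first $N$ positive integers (over all of them if $N=\infty$), where $r_{ij}\in\mathbb R$, $r_{ij}=r_{ji}$, $r_{ii}=0$, $r_{ik}\le r_{ij}+r_{jk}$ and $b_i\in B$, with the Borel $\sigma$-algebra of entrywise convergence and the extended metric $$\rho_N\big((r,b),(r',b')\big)=\max\Big\{\tfrac12\sup_{i,j}|r_{ij}-r'_{ij}|,\ \sup_i d_B(b_i,b'_i)\Big\}\in[0,\infty]$$ (suprema over the empty set being $0$). The augmented distance matrix distribution $\mathcal D^N_{\mathcal X}$ is the push-forward of the product measure $\mu_X^{N}$ under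 $X^N\to\mathcal R_B^N$, $(x_i)\mapsto\big((d_X(x_i,x_j)),(\pi_X(x_i))\big)$; write $\mathcal D_{\mathcal X}=\mathcal D_{\mathcal X}^\infty$. For probability measures $\alpha,\beta$ on $\mathcal R_B^N$ let $$d_{W,p}(\alpha,\beta)=\inf_{\gamma\in C(\alpha,\beta)}\Big(\int\rho_N^p\,d\gamma\Big)^{1/p}\quad(1\le p<\infty),\qquad d_{W,\infty}(\alpha,\beta)=\inf_{\gamma\in C(\alpha,\beta)}\operatorname*{ess\,sup}_{\gamma}\rho_N .$$ Finally, let $$d_{GW,\infty}(\mathcal X,\mathcal Y)=\inf_{\gamma\in C(\mu_X,\mu_Y)}\max\Big\{\tfrac12\sup_{((x,y),(x',y'))\in\operatorname{supp}(\gamma\otimes\gamma)}|d_X(x,x')-d_Y(y,y')|,\ \sup_{(x,y)\in\operatorname{supp}\gamma}d_B(\pi_X(x),\pi_Y(y))\Big\}.$$ **Theorem.** Let $\mathcal X$ and $\mathcal Y$ be bounded mm-fields over $B$ and let $1\le p\le\infty$. Then $d_{W,p}(\mathcal D^n_{\mathcal X},\mathcal D^n_{\mathcal Y})$ is nondecreasing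 in $n$, and $$\lim_{n\to\infty}d_{W,p}(\mathcal D^n_{\mathcal X},\mathcal D^n_{\mathcal Y})=d_{W,p}(\mathcal D_{\mathcal X},\mathcal D_{\mathcal Y})=d_{GW,\infty}(\mathcal X,\mathcal Y)<\infty .$$ -/

import Mathlib

open MeasureTheory Filter Topology
open scoped ENNReal

universe u v w

/-- A metric-measure field over a metric space `B`: a complete separable metric space together with
a 1-Lipschitz map to `B` and a Borel probability measure. (For metric spaces, second countability is
the same as separability.) -/
structure MMField (B : Type u) [MetricSpace B] where
  carrier : Type v
  [metricSpace : MetricSpace carrier]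
  [completeSpace : CompleteSpace carrier]
  [secondCountable : SecondCountableTopology carrier]
  [measurableSpace : MeasurableSpace carrier]
  [borelSpace : BorelSpace carrier]
  proj : carrier → B
  lipschitz : LipschitzWith 1 proj
  measure : Measure carrier
  [isProbability : IsProbabilityMeasure measure]

namespace MMField

attribute [instance] MMField.metricSpace MMField.completeSpace MMField.secondCountable
  MMField.measurableSpace MMField.borelSpace MMField.isProbability

/-- A field is bounded if its domain has finite diameter. -/
def IsBounded {B : Type u} [MetricSpace B] (X : MMField.{u, v} B) : Prop :=
  Bornology.IsBounded (Set.univ : Set X.carrier)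

end MMField

/-- The couplings of two measures: measures on the product with the given marginals. -/
def couplings {Ω : Type v} {Ω' : Type w} [MeasurableSpace Ω] [MeasurableSpace Ω']
    (α : Measure Ω) (β : Measure Ω') : Set (Measure (Ω × Ω')) :=
  {γ | γ.map Prod.fst = α ∧ γ.map Prod.snd = β}

/-- The `p`-Wasserstein distance between two measures with respect to a distance function `c` with
values in `[0, ∞]`: the infimum over all couplings `γ` of the `L^p(γ)` norm of `c`, that is, of
`(∫ c ^ p dγ) ^ (1 / p)` for `1 ≤ p < ∞`, and of the `γ`-essential supremum of `c` for `p = ∞`. -/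
noncomputable def wassersteinDist {Ω : Type v} [MeasurableSpace Ω] (c : Ω → Ω → ℝ≥0∞) (p : ℝ≥0∞)
    (α β : Measure Ω) : ℝ≥0∞ :=
  ⨅ γ ∈ couplings α β, eLpNorm (fun z : Ω × Ω => c z.1 z.2) p γ

namespace MMField

/-- The Gromov-Wasserstein distance of order `∞`: the infimum over all couplings `γ` of the maximum
of half the supremum of `|d_X(x, x') - d_Y(y, y')|` over the support of `γ ⊗ γ` and the supremum of
`d_B(π_X x, π_Y y)` over the support of `γ`. -/
noncomputable def gromovWassersteinTop {B : Type u} [MetricSpace B]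
    (X : MMField.{u, v} B) (Y : MMField.{u, w} B) : ℝ≥0∞ :=
  ⨅ γ ∈ couplings X.measure Y.measure,
    max (2⁻¹ * ⨆ z ∈ (γ.prod γ).support,
          ENNReal.ofReal |dist z.1.1 z.2.1 - dist z.1.2 z.2.2|)
      (⨆ z ∈ γ.support, ENNReal.ofReal (dist (X.proj z.1) (Y.proj z.2)))

end MMField

/-- Pseudo-distance matrices indexed by `ι`, with the sigma-algebra induced from the product. -/
abbrev PseudoDistMatrix (ι : Type*) : Type _ :=
  {r : ι → ι → ℝ // (∀ i j, r i j = r j i) ∧ (∀ i, r i i = 0) ∧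
    ∀ i j k, r i k ≤ r i j + r j k}

/-- Augmented distance matrices indexed by `ι`: a pseudo-distance matrix together with a family of
points of `B`. With `B` a separable metric space and `ι` countable, the sigma-algebra is the Borel
sigma-algebra of the topology of entrywise convergence. -/
abbrev AugDistMatrix (ι : Type*) (B : Type u) : Type _ :=
  PseudoDistMatrix ι × (ι → B)

namespace AugDistMatrix

/-- The (extended) distance
`max (1/2 * sup_{i,j} |r_{ij} - r'_{ij}|) (sup_i d_B(b_i, b'_i))`. -/
noncomputable def rho {ι : Type*} {B : Type u} [MetricSpace B] (a a' : AugDistMatrix ι B) : ℝ≥0∞ :=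
  max (2⁻¹ * ⨆ i, ⨆ j, ENNReal.ofReal |a.1.1 i j - a'.1.1 i j|)
    (⨆ i, ENNReal.ofReal (dist (a.2 i) (a'.2 i)))

end AugDistMatrix

namespace MMField

/-- The augmented distance matrix `((d_X(x_i, x_j))_{ij}, (π_X(x_i))_i)` of a family of points. -/
def adm {B : Type u} [MetricSpace B] (X : MMField.{u, v} B) (ι : Type*) (x : ι → X.carrier) :
    AugDistMatrix ι B :=
  (⟨fun i j => dist (x i) (x j), fun _ _ => dist_comm _ _, fun _ => dist_self _,
    fun _ _ _ => dist_triangle _ _ _⟩, fun i => X.proj (x i))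

/-- The augmented distance matrix map is measurable, so that its push-forwards are meaningful. -/
theorem measurable_adm {B : Type u} [MetricSpace B] [MeasurableSpace B] [BorelSpace B]
    (X : MMField.{u, v} B) (ι : Type*) : Measurable (X.adm ι) := by
  refine Measurable.prodMk (Measurable.subtype_mk ?_) ?_
  · exact measurable_pi_iff.2 fun i => measurable_pi_iff.2 fun j =>
      (measurable_pi_apply i).dist (measurable_pi_apply j)
  · exact measurable_pi_iff.2 fun i =>
      X.lipschitz.continuous.measurable.comp (measurable_pi_apply i)

/-- The distribution of the `n × n` augmented distance matrix of `n` independent points. -/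
noncomputable def admDistribution {B : Type u} [MetricSpace B] [MeasurableSpace B]
    (X : MMField.{u, v} B) (n : ℕ) : Measure (AugDistMatrix (Fin n) B) :=
  (Measure.pi fun _ : Fin n => X.measure).map (X.adm (Fin n))

/-- The distribution of the infinite augmented distance matrix of a sequence of independent
points. -/
noncomputable def admDistributionInfty {B : Type u} [MetricSpace B] [MeasurableSpace B]
    (X : MMField.{u, v} B) : Measure (AugDistMatrix ℕ B) :=
  (Measure.infinitePi fun _ : ℕ => X.measure).map (X.adm ℕ)

end MMField

/-! Passing to a subfamily of the indices does not increase `rho` and sends matrix laws to matrix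
laws. So the distances increase with `n` and stay below the one for infinite matrices
(`wassersteinDist_admLaw_le`). Independent draws from a coupling `γ` of the two fields couple the
matrix laws, and almost surely all draws lie in the support of `γ`, so the cost is at most the
distortion of `γ` (`wassersteinDist_admLaw_le_gromovWassersteinTop`).

It remains to bound the Gromov-Wasserstein distance by the supremum over finite `n`, where `p = 1`
suffices. If all distances are below `a < c`, Markov's inequality gives couplings with `rho < c` on
mass at least `1 - a / c`, uniformly in `n`. By Varadarajan's theorem the empirical measures
approximate the laws of the fields with probability tending to one, so for large `n` both happen at
once (`exists_samples`). Pairing the two samples by index gives joint empirical measures that are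
tight and have a coupling as limit. Each point of its support is approached by sample pairs, so its
distortion is at most `c` (`gromovWassersteinTop_le_of_samples`). -/

/-! ### Wasserstein distances for a general cost -/

/-- The Wasserstein distance does not increase under maps that do not increase the cost. -/
theorem wassersteinDist_map_le {Ω : Type*} {Ω' : Type*} [MeasurableSpace Ω] [MeasurableSpace Ω']
    {c : Ω → Ω → ℝ≥0∞} {c' : Ω' → Ω' → ℝ≥0∞} (hc' : Measurable fun z : Ω' × Ω' => c' z.1 z.2)
    {f : Ω → Ω'} (hf : Measurable f) (h : ∀ a b, c' (f a) (f b) ≤ c a b) (p : ℝ≥0∞)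
    (α β : Measure Ω) :
    wassersteinDist c' p (α.map f) (β.map f) ≤ wassersteinDist c p α β := by
  refine le_iInf₂ fun γ hγ => ?_
  have hff : Measurable (Prod.map f f) := hf.prodMap hf
  have hmem : γ.map (Prod.map f f) ∈ couplings (α.map f) (β.map f) := by
    refine ⟨?_, ?_⟩
    · rw [Measure.map_map measurable_fst hff, ← hγ.1, Measure.map_map hf measurable_fst]
      rfl
    · rw [Measure.map_map measurable_snd hff, ← hγ.2, Measure.map_map hf measurable_snd]
      rfl
  refine (iInf₂_le _ hmem).trans ?_
  · rw [eLpNorm_map_measure hc'.aestronglyMeasurable hff.aemeasurable]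
    exact eLpNorm_mono_enorm fun z => by simpa using h z.1 z.2

theorem isProbabilityMeasure_of_mem_couplings {Ω : Type*} {Ω' : Type*} [MeasurableSpace Ω]
    [MeasurableSpace Ω'] {α : Measure Ω} {β : Measure Ω'} [IsProbabilityMeasure α]
    {γ : Measure (Ω × Ω')} (hγ : γ ∈ couplings α β) : IsProbabilityMeasure γ := by
  refine ⟨?_⟩
  have h := measure_univ (μ := α)
  rwa [← hγ.1, Measure.map_apply measurable_fst .univ, Set.preimage_univ] at h

theorem wassersteinDist_mono_exponent {Ω : Type*} [MeasurableSpace Ω] {c : Ω → Ω → ℝ≥0∞}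
    (hc : Measurable fun z : Ω × Ω => c z.1 z.2) {p q : ℝ≥0∞} (hpq : p ≤ q)
    (α β : Measure Ω) [IsProbabilityMeasure α] :
    wassersteinDist c p α β ≤ wassersteinDist c q α β := by
  refine iInf₂_mono fun γ hγ => ?_
  have := isProbabilityMeasure_of_mem_couplings hγ
  exact eLpNorm_le_eLpNorm_of_exponent_le hpq hc.aestronglyMeasurable

/-- Markov's inequality: if the Wasserstein distance of order one is less than `a`, there is a
coupling for which the cost is at least `c` with probability at most `a / c`. -/
theorem exists_coupling_measure_ge_le_div {Ω : Type*} [MeasurableSpace Ω] {d : Ω → Ω → ℝ≥0∞}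
    (hd : Measurable fun z : Ω × Ω => d z.1 z.2) {α β : Measure Ω} {a c : ℝ≥0∞}
    (h : wassersteinDist d 1 α β < a) (hc : c ≠ ∞) (hc0 : c ≠ 0) :
    ∃ γ ∈ couplings α β, γ {z | c ≤ d z.1 z.2} ≤ a / c := by
  simp only [wassersteinDist, iInf_lt_iff] at h
  obtain ⟨γ, hγ, h⟩ := h
  refine ⟨γ, hγ, ?_⟩
  rw [eLpNorm_one_eq_lintegral_enorm] at h
  refine (meas_ge_le_lintegral_div hd.aemeasurable hc0 hc).trans ?_
  gcongr
  exact h.le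

/-! ### Augmented distance matrices and reindexing -/

namespace AugDistMatrix

theorem rho_le_iff {ι : Type*} {B : Type u} [MetricSpace B] {a a' : AugDistMatrix ι B}
    {c : ℝ≥0∞} :
    rho a a' ≤ c ↔ (∀ i j, 2⁻¹ * ENNReal.ofReal |a.1.1 i j - a'.1.1 i j| ≤ c) ∧
      ∀ i, ENNReal.ofReal (dist (a.2 i) (a'.2 i)) ≤ c := by
  simp only [rho, max_le_iff, ENNReal.mul_iSup, iSup_le_iff]

/-- The augmented distance matrix with reindexed rows and columns. -/
def reindex {ι κ : Type*} {B : Type u} (f : ι → κ) (a : AugDistMatrix κ B) : AugDistMatrix ι B :=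
  (⟨fun i j => a.1.1 (f i) (f j), fun _ _ => a.1.2.1 _ _, fun _ => a.1.2.2.1 _,
    fun _ _ _ => a.1.2.2.2 _ _ _⟩, fun i => a.2 (f i))

theorem measurable_entry {ι : Type*} {B : Type u} [MeasurableSpace B] (i j : ι) :
    Measurable fun a : AugDistMatrix ι B => a.1.1 i j :=
  (measurable_pi_apply j).comp ((measurable_pi_apply i).comp
    (measurable_subtype_coe.comp measurable_fst))

theorem measurable_reindex {ι κ : Type*} {B : Type u} [MeasurableSpace B] (f : ι → κ) :
    Measurable (reindex (B := B) f) := by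
  refine Measurable.prodMk (Measurable.subtype_mk ?_) (by fun_prop)
  exact measurable_pi_iff.2 fun i => measurable_pi_iff.2 fun j => measurable_entry (f i) (f j)

theorem rho_reindex_le {ι κ : Type*} {B : Type u} [MetricSpace B] (f : ι → κ)
    (a a' : AugDistMatrix κ B) : rho (reindex f a) (reindex f a') ≤ rho a a' := by
  have h := rho_le_iff.1 (le_refl (rho a a'))
  exact rho_le_iff.2 ⟨fun i j => h.1 (f i) (f j), fun i => h.2 (f i)⟩

theorem measurable_rho {ι : Type*} [Countable ι] {B : Type u} [MetricSpace B]
    [SecondCountableTopology B] [MeasurableSpace B] [BorelSpace B] :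
    Measurable fun z : AugDistMatrix ι B × AugDistMatrix ι B => rho z.1 z.2 := by
  unfold rho
  refine Measurable.max (Measurable.const_mul (.iSup fun i => .iSup fun j => ?_) _)
    (.iSup fun i => ?_)
  · refine ENNReal.measurable_ofReal.comp (measurable_abs.comp (Measurable.sub
      ((measurable_entry i j).comp measurable_fst) ((measurable_entry i j).comp measurable_snd)))
  · refine ENNReal.measurable_ofReal.comp (Measurable.dist ?_ ?_) <;> fun_prop

end AugDistMatrix

/-! ### Matrix laws and monotonicity in the index set -/

namespace MMField

variable {B : Type u} [MetricSpace B]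

/-- The distribution of the augmented distance matrix of a family of independent points. -/
noncomputable def admLaw [MeasurableSpace B] (X : MMField.{u, v} B) (ι : Type*) :
    Measure (AugDistMatrix ι B) :=
  (Measure.infinitePi fun _ : ι => X.measure).map (X.adm ι)

theorem admDistribution_eq_admLaw [MeasurableSpace B] (X : MMField.{u, v} B) (n : ℕ) :
    X.admDistribution n = X.admLaw (Fin n) := by
  rw [admDistribution, admLaw, Measure.infinitePi_eq_pi]

theorem admDistributionInfty_eq_admLaw [MeasurableSpace B] (X : MMField.{u, v} B) :
    X.admDistributionInfty = X.admLaw ℕ := rfl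

instance [MeasurableSpace B] [BorelSpace B] (X : MMField.{u, v} B) (ι : Type*) :
    IsProbabilityMeasure (X.admLaw ι) :=
  Measure.isProbabilityMeasure_map (X.measurable_adm ι).aemeasurable

/-- Distinct coordinates of an i.i.d. family are again i.i.d.; injectivity rules out repeated
points. -/
theorem admLaw_map_reindex [MeasurableSpace B] [BorelSpace B] (X : MMField.{u, v} B)
    {ι κ : Type*} {f : ι → κ} (hf : f.Injective) :
    (X.admLaw κ).map (AugDistMatrix.reindex f) = X.admLaw ι := by
  rw [admLaw, admLaw, Measure.map_map (AugDistMatrix.measurable_reindex f) (X.measurable_adm κ),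
    ← Measure.map_infinitePi_infinitePi_of_inj (P := fun _ => X.measure) hf,
    Measure.map_map (X.measurable_adm ι)
      (by fun_prop)]
  rfl

theorem wassersteinDist_admLaw_le [SecondCountableTopology B] [MeasurableSpace B] [BorelSpace B]
    (X : MMField.{u, v} B) (Y : MMField.{u, w} B) (p : ℝ≥0∞) {ι κ : Type*} [Countable ι]
    {f : ι → κ} (hf : f.Injective) :
    wassersteinDist AugDistMatrix.rho p (X.admLaw ι) (Y.admLaw ι) ≤
      wassersteinDist AugDistMatrix.rho p (X.admLaw κ) (Y.admLaw κ) := by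
  rw [← X.admLaw_map_reindex hf, ← Y.admLaw_map_reindex hf]
  exact wassersteinDist_map_le AugDistMatrix.measurable_rho (AugDistMatrix.measurable_reindex f)
    (AugDistMatrix.rho_reindex_le f) p _ _

end MMField

/-! ### The upper bound by couplings of the fields, and finiteness -/

theorem MeasureTheory.Measure.mem_support_prod {α β : Type*} [TopologicalSpace α]
    [TopologicalSpace β] [MeasurableSpace α] [MeasurableSpace β]
    {μ : Measure α} {ν : Measure β} [SFinite μ] [SFinite ν] {z : α × β} :
    z ∈ (μ.prod ν).support ↔ z.1 ∈ μ.support ∧ z.2 ∈ ν.support := by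
  simp only [Measure.mem_support_iff_forall]
  constructor
  · refine fun h => ⟨fun U hU => ?_, fun U hU => ?_⟩
    · have := h (U ×ˢ Set.univ) (prod_mem_nhds hU univ_mem)
      rw [Measure.prod_prod] at this
      exact pos_of_ne_zero (left_ne_zero_of_mul this.ne')
    · have := h (Set.univ ×ˢ U) (prod_mem_nhds univ_mem hU)
      rw [Measure.prod_prod] at this
      exact pos_of_ne_zero (right_ne_zero_of_mul this.ne')
  · intro h W hW
    obtain ⟨U, hU, V, hV, hUV⟩ := mem_nhds_prod_iff.1 hW
    refine lt_of_lt_of_le ?_ (measure_mono hUV)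
    rw [Measure.prod_prod]
    exact ENNReal.mul_pos (h.1 U hU).ne' (h.2 V hV).ne'

namespace MMField

variable {B : Type u} [MetricSpace B]

/-- The distortion of a measure on the product of two fields, in terms of pairs of points of its
support. -/
theorem max_distortion_le_iff (X : MMField.{u, v} B) (Y : MMField.{u, w} B)
    {γ : Measure (X.carrier × Y.carrier)} [SFinite γ] {c : ℝ≥0∞} :
    max (2⁻¹ * ⨆ z ∈ (γ.prod γ).support,
          ENNReal.ofReal |dist z.1.1 z.2.1 - dist z.1.2 z.2.2|)
      (⨆ z ∈ γ.support, ENNReal.ofReal (dist (X.proj z.1) (Y.proj z.2))) ≤ c ↔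
    (∀ z ∈ γ.support, ∀ z' ∈ γ.support,
      2⁻¹ * ENNReal.ofReal |dist z.1 z'.1 - dist z.2 z'.2| ≤ c) ∧
    ∀ z ∈ γ.support, ENNReal.ofReal (dist (X.proj z.1) (Y.proj z.2)) ≤ c := by
  simp only [max_le_iff, ENNReal.mul_iSup, iSup_le_iff, Measure.mem_support_prod]
  refine and_congr_left fun _ => ⟨fun h z hz z' hz' => h (z, z') ⟨hz, hz'⟩,
    fun h z hz => h _ hz.1 _ hz.2⟩

theorem gromovWassersteinTop_le_of_mem (X : MMField.{u, v} B) (Y : MMField.{u, w} B)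
    {γ : Measure (X.carrier × Y.carrier)} (hγ : γ ∈ couplings X.measure Y.measure) {c : ℝ≥0∞}
    (h1 : ∀ z ∈ γ.support, ∀ z' ∈ γ.support,
      2⁻¹ * ENNReal.ofReal |dist z.1 z'.1 - dist z.2 z'.2| ≤ c)
    (h2 : ∀ z ∈ γ.support, ENNReal.ofReal (dist (X.proj z.1) (Y.proj z.2)) ≤ c) :
    X.gromovWassersteinTop Y ≤ c :=
  have := isProbabilityMeasure_of_mem_couplings hγ
  (iInf₂_le γ hγ).trans ((X.max_distortion_le_iff Y).2 ⟨h1, h2⟩)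

theorem wassersteinDist_admLaw_le_gromovWassersteinTop [SecondCountableTopology B]
    [MeasurableSpace B] [BorelSpace B] (X : MMField.{u, v} B) (Y : MMField.{u, w} B) (p : ℝ≥0∞)
    (ι : Type*) [Countable ι] :
    wassersteinDist AugDistMatrix.rho p (X.admLaw ι) (Y.admLaw ι) ≤ X.gromovWassersteinTop Y := by
  refine le_iInf₂ fun γ hγ => le_of_forall_ge fun c hc => ?_
  have := isProbabilityMeasure_of_mem_couplings hγ
  obtain ⟨h1, h2⟩ := (X.max_distortion_le_iff Y (γ := γ)).1 hc
  have hfst : Measurable fun (z : ι → X.carrier × Y.carrier) i => (z i).1 := by fun_prop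
  have hsnd : Measurable fun (z : ι → X.carrier × Y.carrier) i => (z i).2 := by fun_prop
  let F : (ι → X.carrier × Y.carrier) → AugDistMatrix ι B × AugDistMatrix ι B :=
    fun z => (X.adm ι fun i => (z i).1, Y.adm ι fun i => (z i).2)
  have hF : Measurable F :=
    ((X.measurable_adm ι).comp hfst).prodMk ((Y.measurable_adm ι).comp hsnd)
  have hmem : (Measure.infinitePi fun _ : ι => γ).map F ∈ couplings (X.admLaw ι) (Y.admLaw ι) := by
    refine ⟨?_, ?_⟩
    · rw [Measure.map_map measurable_fst hF, admLaw, ← hγ.1,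
        ← Measure.infinitePi_map_pi _ fun _ => measurable_fst,
        Measure.map_map (X.measurable_adm ι) hfst]
      rfl
    · rw [Measure.map_map measurable_snd hF, admLaw, ← hγ.2,
        ← Measure.infinitePi_map_pi _ fun _ => measurable_snd,
        Measure.map_map (Y.measurable_adm ι) hsnd]
      rfl
  refine (iInf₂_le _ hmem).trans ?_
  · rw [eLpNorm_map_measure AugDistMatrix.measurable_rho.aestronglyMeasurable hF.aemeasurable]
    have hsupp : ∀ᵐ z ∂(Measure.infinitePi fun _ : ι => γ), ∀ i, z i ∈ γ.support :=
      ae_all_iff.2 fun i =>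
        (measurePreserving_eval_infinitePi (fun _ : ι => γ) i).quasiMeasurePreserving.ae
          Measure.support_mem_ae
    calc _ ≤ eLpNorm (fun _ => c) p (Measure.infinitePi fun _ : ι => γ) := by
          refine eLpNorm_mono_enorm_ae (hsupp.mono fun z hz => ?_)
          exact AugDistMatrix.rho_le_iff.2
            ⟨fun i j => h1 _ (hz i) _ (hz j), fun i => h2 _ (hz i)⟩
      _ ≤ c := by
          -- `eLpNorm` with exponent `0` is `0` by convention.
          rcases eq_or_ne p 0 with rfl | hp
          · simp
          · rw [eLpNorm_const _ hp (IsProbabilityMeasure.ne_zero _)]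
            simp

theorem gromovWassersteinTop_ne_top (X : MMField.{u, v} B) (Y : MMField.{u, w} B)
    (hX : X.IsBounded) (hY : Y.IsBounded) : X.gromovWassersteinTop Y ≠ ∞ := by
  obtain ⟨C, hC⟩ := Metric.isBounded_iff.1 hX
  obtain ⟨D, hD⟩ := Metric.isBounded_iff.1 hY
  obtain ⟨x₀⟩ := nonempty_of_isProbabilityMeasure X.measure
  obtain ⟨y₀⟩ := nonempty_of_isProbabilityMeasure Y.measure
  have hC' : ∀ x x' : X.carrier, dist x x' ≤ C := fun x x' => hC trivial trivial
  have hD' : ∀ y y' : Y.carrier, dist y y' ≤ D := fun y y' => hD trivial trivial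
  -- The product coupling has finite distortion: distances differ by at most `C + D`, and
  -- projections are compared through the base points.
  refine ne_top_of_le_ne_top
    (b := ENNReal.ofReal (C + D + dist (X.proj x₀) (Y.proj y₀))) ENNReal.ofReal_ne_top ?_
  refine X.gromovWassersteinTop_le_of_mem Y (γ := X.measure.prod Y.measure)
    ⟨by simp, by simp⟩ (fun z _ z' _ => ?_) fun z _ => ?_
  · refine (mul_le_of_le_one_left' (by simp)).trans (ENNReal.ofReal_le_ofReal ?_)
    have h1 := hC' z.1 z'.1
    have h2 := hD' z.2 z'.2
    have h3 : 0 ≤ dist z.1 z'.1 := dist_nonneg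
    have h4 : 0 ≤ dist z.2 z'.2 := dist_nonneg
    have h5 : 0 ≤ dist (X.proj x₀) (Y.proj y₀) := dist_nonneg
    exact abs_le.2 ⟨by linarith, by linarith⟩
  · refine ENNReal.ofReal_le_ofReal ?_
    have h1 := (X.lipschitz.dist_le_mul z.1 x₀).trans
      (mul_le_mul_of_nonneg_left (hC' z.1 x₀) NNReal.zero_le_coe)
    have h2 := (Y.lipschitz.dist_le_mul y₀ z.2).trans
      (mul_le_mul_of_nonneg_left (hD' y₀ z.2) NNReal.zero_le_coe)
    simp only [NNReal.coe_one, one_mul] at h1 h2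
    linarith [dist_triangle4 (X.proj z.1) (X.proj x₀) (Y.proj y₀) (Y.proj z.2)]

end MMField

/-! ### Empirical measures and Varadarajan's theorem -/

namespace MeasureTheory

section Empirical

variable {ι : Type*} [Fintype ι] [Nonempty ι] [MeasurableSpace ι] [MeasurableSingletonClass ι]

/-- The uniform probability measure on a finite nonempty type. -/
noncomputable def uniformProbability (ι : Type*) [Fintype ι] [Nonempty ι] [MeasurableSpace ι] :
    ProbabilityMeasure ι :=
  ⟨(PMF.uniformOfFintype ι).toMeasure, inferInstance⟩

theorem uniformProbability_real_singleton (i : ι) :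
    (uniformProbability ι : Measure ι).real {i} = (Fintype.card ι : ℝ)⁻¹ := by
  rw [measureReal_def, uniformProbability, ProbabilityMeasure.coe_mk,
    PMF.toMeasure_apply_singleton _ _ (measurableSet_singleton i)]
  simp

/-- The empirical measure of a finite nonempty family of points. -/
noncomputable def empiricalMeasure {E : Type*} [MeasurableSpace E] (x : ι → E) :
    ProbabilityMeasure E :=
  (uniformProbability ι).map (measurable_of_finite x).aemeasurable

variable {E : Type*} [MeasurableSpace E]

theorem coe_empiricalMeasure (x : ι → E) :
    (empiricalMeasure x : Measure E) = (uniformProbability ι : Measure ι).map x := rfl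

theorem integral_empiricalMeasure (x : ι → E) {f : E → ℝ} (hf : StronglyMeasurable f) :
    ∫ e, f e ∂(empiricalMeasure x : Measure E) = (Fintype.card ι : ℝ)⁻¹ * ∑ i, f (x i) := by
  rw [coe_empiricalMeasure, integral_map (measurable_of_finite x).aemeasurable
    hf.aestronglyMeasurable, integral_fintype .of_finite, Finset.mul_sum]
  simp_rw [uniformProbability_real_singleton, smul_eq_mul]

/-- Integrals of bounded continuous functions become finite averages, continuous in the sample. This
makes events about empirical measures measurable. -/
theorem continuous_empiricalMeasure [TopologicalSpace E] [OpensMeasurableSpace E] :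
    Continuous fun x : ι → E => empiricalMeasure x := by
  refine continuous_iff_continuousAt.2 fun x => ?_
  refine ProbabilityMeasure.tendsto_iff_forall_integral_tendsto.2 fun f => ?_
  simp_rw [integral_empiricalMeasure _ f.continuous.stronglyMeasurable]
  refine Continuous.tendsto ?_ x
  fun_prop

theorem exists_mem_of_empiricalMeasure_pos {x : ι → E} {s : Set E} (hs : MeasurableSet s)
    (h : 0 < (empiricalMeasure x : Measure E) s) : ∃ i, x i ∈ s := by
  rw [coe_empiricalMeasure, Measure.map_apply (measurable_of_finite x) hs] at h
  exact nonempty_of_measure_ne_zero h.ne'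

theorem map_empiricalMeasure {F : Type*} [MeasurableSpace F] (x : ι → E) {f : E → F}
    (hf : Measurable f) :
    (empiricalMeasure x).map hf.aemeasurable = empiricalMeasure (f ∘ x) := by
  refine Subtype.ext ?_
  change Measure.map f (Measure.map x _) = Measure.map (f ∘ x) _
  rw [Measure.map_map hf (measurable_of_finite x)]

end Empirical

/-- The strong law of large numbers for the frequency of a measurable set. -/
theorem ae_tendsto_empiricalMeasure_apply {E : Type*} [MeasurableSpace E] (μ : Measure E)
    [IsProbabilityMeasure μ] {s : Set E} (hs : MeasurableSet s) :
    ∀ᵐ x ∂(Measure.infinitePi fun _ : ℕ => μ),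
      Tendsto (fun n => (empiricalMeasure fun i : Fin (n + 1) => x i : Measure E).real s) atTop
        (𝓝 (μ.real s)) := by
  have hf : Measurable (s.indicator fun _ => (1 : ℝ)) := measurable_const.indicator hs
  have hlaw (i : ℕ) : (Measure.infinitePi fun _ : ℕ => μ).map
      (fun x => s.indicator (fun _ => (1 : ℝ)) (x i)) = μ.map (s.indicator fun _ => (1 : ℝ)) := by
    conv_rhs => rw [← Measure.infinitePi_map_eval (fun _ : ℕ => μ) i]
    rw [Measure.map_map hf (measurable_pi_apply i)]
    rfl
  have hm (i : ℕ) : Measurable fun x : ℕ → E => s.indicator (fun _ => (1 : ℝ)) (x i) :=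
    hf.comp (measurable_pi_apply i)
  have key := ProbabilityTheory.strong_law_ae_real
    (μ := Measure.infinitePi fun _ : ℕ => μ)
    (fun i x => s.indicator (fun _ => (1 : ℝ)) (x i))
    (.of_bound (hm 0).aestronglyMeasurable 1 (.of_forall fun x => by
      by_cases h : x 0 ∈ s <;> simp [h]))
    (fun i j hij => (ProbabilityTheory.iIndepFun_infinitePi fun _ => hf).indepFun hij)
    (fun i => ⟨(hm i).aemeasurable, (hm 0).aemeasurable, by rw [hlaw, hlaw]⟩)
  have hint : ∫ x, s.indicator (fun _ => (1 : ℝ)) (x 0) ∂(Measure.infinitePi fun _ : ℕ => μ) =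
      μ.real s := by
    rw [← integral_map (φ := fun x : ℕ → E => x 0) (measurable_pi_apply 0).aemeasurable hf.aestronglyMeasurable,
      Measure.infinitePi_map_eval (fun _ : ℕ => μ) 0, integral_indicator_const _ hs]
    simp
  rw [hint] at key
  filter_upwards [key] with x hx
  -- The shift by one is due to empirical measures being defined for nonempty samples only.
  refine ((tendsto_add_atTop_iff_nat 1).2 hx).congr fun n => ?_
  have h := integral_empiricalMeasure (fun i : Fin (n + 1) => x i) hf.stronglyMeasurable
  rw [integral_indicator_const _ hs, Fintype.card_fin, smul_eq_mul, mul_one] at h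
  rw [h, ← Fin.sum_univ_eq_sum_range (fun i => s.indicator (fun _ => (1 : ℝ)) (x i)), div_eq_inv_mul]

/-- **Varadarajan's theorem**: almost surely, the empirical measures converge weakly. -/
theorem ae_tendsto_empiricalMeasure {E : Type*} [TopologicalSpace E] [SecondCountableTopology E]
    [MeasurableSpace E] [OpensMeasurableSpace E] [HasOuterApproxClosed E]
    (μ : ProbabilityMeasure E) :
    ∀ᵐ x ∂(Measure.infinitePi fun _ : ℕ => (μ : Measure E)),
      Tendsto (fun n => empiricalMeasure fun i : Fin (n + 1) => x i) atTop (𝓝 μ) := by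
  set b := TopologicalSpace.countableBasis E
  have hb := TopologicalSpace.isBasis_countableBasis E
  -- A countable π-system containing a basis: the law of large numbers holds for all its members off
  -- a single null set, and this determines weak convergence.
  set S : Set (Set E) := (fun f : Set (Set E) => ⋂₀ f) '' {f | f.Finite ∧ f ⊆ b}
  have hSc : S.Countable :=
    (Set.countable_ofPred_finite_subset (TopologicalSpace.countable_countableBasis E)).image _
  have hSo : ∀ s ∈ S, IsOpen s := by
    rintro _ ⟨f, ⟨hf, hfb⟩, rfl⟩
    exact hf.isOpen_sInter fun t ht => hb.isOpen (hfb ht)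
  have hS : IsPiSystem S := by
    rintro _ ⟨f, ⟨hf, hfb⟩, rfl⟩ _ ⟨g, ⟨hg, hgb⟩, rfl⟩ -
    exact ⟨f ∪ g, ⟨hf.union hg, Set.union_subset hfb hgb⟩, Set.sInter_union f g⟩
  have h := (ae_ball_iff hSc).2 fun s hs =>
    ae_tendsto_empiricalMeasure_apply (μ : Measure E) (hSo s hs).measurableSet
  filter_upwards [h] with x hx
  refine hS.tendsto_probabilityMeasure_of_tendsto_of_mem (fun s hs => (hSo s hs).measurableSet)
    (fun U hU e he => ?_) fun s hs => ?_
  · obtain ⟨t, ht, het, htU⟩ := hb.exists_subset_of_mem_open he hU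
    have htS : t ∈ S := ⟨{t}, ⟨Set.finite_singleton t, by simpa using ht⟩, by simp⟩
    exact ⟨t, htS, (hSo t htS).mem_nhds het, htU⟩
  · exact NNReal.tendsto_coe.1 (hx s hs)

/-- The empirical measures of independent samples are close to the law of the samples with
probability tending to one. -/
theorem tendsto_measure_empiricalMeasure_mem {E : Type*} [TopologicalSpace E]
    [SecondCountableTopology E] [MeasurableSpace E] [BorelSpace E] [HasOuterApproxClosed E]
    (μ : ProbabilityMeasure E) {V : Set (ProbabilityMeasure E)} (hV : IsOpen V) (hμ : μ ∈ V) :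
    Tendsto (fun n => (Measure.infinitePi fun _ : Fin (n + 1) => (μ : Measure E))
      ((fun x => empiricalMeasure x) ⁻¹' V)) atTop (𝓝 1) := by
  have hm (n : ℕ) : MeasurableSet ((fun x : Fin (n + 1) → E => empiricalMeasure x) ⁻¹' V) :=
    (hV.preimage continuous_empiricalMeasure).measurableSet
  have hr (n : ℕ) : Measurable fun (x : ℕ → E) (i : Fin (n + 1)) => x i := by fun_prop
  have h := tendsto_measure_of_ae_tendsto_indicator_of_isFiniteMeasure
    (μ := Measure.infinitePi fun _ : ℕ => (μ : Measure E)) (A := Set.univ)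
    (As := fun n => (fun x : ℕ → E => empiricalMeasure fun i : Fin (n + 1) => x i) ⁻¹' V) atTop .univ
    (fun n => hr n (hm n)) ?_
  · rw [measure_univ] at h
    refine h.congr fun n => ?_
    rw [← Measure.map_infinitePi_infinitePi_of_inj (P := fun _ : ℕ => (μ : Measure E))
      (Fin.val_injective (n := n + 1)), Measure.map_apply (hr n) (hm n)]
    rfl
  · filter_upwards [ae_tendsto_empiricalMeasure μ] with x hx
    filter_upwards [hx.eventually (hV.mem_nhds hμ)] with n hn
    exact iff_of_true hn trivial

/-! ### Compactness of couplings with convergent marginals -/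

/-- A weakly convergent sequence of probability measures is tight. -/
theorem isTightMeasureSet_range_of_tendsto {E : Type*} [MetricSpace E] [CompleteSpace E]
    [SecondCountableTopology E] [MeasurableSpace E] [BorelSpace E] {α : ℕ → ProbabilityMeasure E}
    {μ : ProbabilityMeasure E} (h : Tendsto α atTop (𝓝 μ)) :
    IsTightMeasureSet {m : Measure E | ∃ n, (α n : Measure E) = m} := by
  -- The sequence together with its limit is compact, hence tight on a Polish space.
  have hc := h.isCompact_insert_range
  refine (isTightMeasureSet_of_isCompact_closure (hc.closure)).subset ?_
  rintro _ ⟨n, rfl⟩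
  exact ⟨α n, .inr ⟨n, rfl⟩, rfl⟩

/-- Couplings with convergent marginals have a limit along an ultrafilter. -/
theorem exists_tendsto_hyperfilter_of_tendsto_marginals {E F : Type*} [MetricSpace E]
    [CompleteSpace E] [SecondCountableTopology E] [MeasurableSpace E] [BorelSpace E]
    [MetricSpace F] [CompleteSpace F] [SecondCountableTopology F] [MeasurableSpace F]
    [BorelSpace F] {γ : ℕ → ProbabilityMeasure (E × F)} {μ : ProbabilityMeasure E}
    {ν : ProbabilityMeasure F}
    (h1 : Tendsto (fun n => (γ n).map measurable_fst.aemeasurable) atTop (𝓝 μ))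
    (h2 : Tendsto (fun n => (γ n).map measurable_snd.aemeasurable) atTop (𝓝 ν)) :
    ∃ γ' : ProbabilityMeasure (E × F), Tendsto γ (hyperfilter ℕ) (𝓝 γ') ∧
      (γ' : Measure (E × F)) ∈ couplings (μ : Measure E) (ν : Measure F) := by
  have ht : IsTightMeasureSet {m : Measure (E × F) | ∃ p ∈ Set.range γ, (p : Measure (E × F)) = m} := by
    refine IsTightMeasureSet.prodMk
      ((isTightMeasureSet_range_of_tendsto h1).subset ?_)
      ((isTightMeasureSet_range_of_tendsto h2).subset ?_) <;>
    · rintro _ ⟨_, ⟨_, ⟨n, rfl⟩, rfl⟩, rfl⟩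
      exact ⟨n, rfl⟩
  have hc := isCompact_closure_of_isTightMeasureSet (S := Set.range γ) (by simpa using ht)
  obtain ⟨γ', -, hγ'⟩ := hc.ultrafilter_le_nhds ((hyperfilter ℕ).map γ)
    (le_principal_iff.2 (mem_map.2 (univ_mem' fun n => subset_closure ⟨n, rfl⟩)))
  have hγ : Tendsto γ (hyperfilter ℕ) (𝓝 γ') := hγ'
  have hle : (hyperfilter ℕ : Filter ℕ) ≤ atTop := Nat.hyperfilter_le_atTop
  refine ⟨γ', hγ, ?_, ?_⟩
  · have : γ'.map measurable_fst.aemeasurable = μ := tendsto_nhds_unique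
      (((ProbabilityMeasure.continuous_map continuous_fst).tendsto γ').comp hγ) (h1.mono_left hle)
    exact congrArg Subtype.val this
  · have : γ'.map measurable_snd.aemeasurable = ν := tendsto_nhds_unique
      (((ProbabilityMeasure.continuous_map continuous_snd).tendsto γ').comp hγ) (h2.mono_left hle)
    exact congrArg Subtype.val this

end MeasureTheory

/-! ### The lower bound: from matrix laws back to a coupling -/

namespace MMField

variable {B : Type u} [MetricSpace B]

/-- The measure of a field as a term of the type of probability measures. -/
noncomputable def law (X : MMField.{u, v} B) : ProbabilityMeasure X.carrier :=
  ⟨X.measure, X.isProbability⟩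

theorem continuous_adm (X : MMField.{u, v} B) (ι : Type*) : Continuous (X.adm ι) := by
  refine Continuous.prodMk (Continuous.subtype_mk ?_ _) ?_
  · fun_prop
  · exact continuous_pi fun i => X.lipschitz.continuous.comp (continuous_apply i)

/-- A set of samples whose probability exceeds `r` contains a set of samples whose augmented
distance matrices form a measurable set of probability exceeding `r`. -/
theorem exists_measurableSet_admLaw_gt [SecondCountableTopology B] [MeasurableSpace B]
    [BorelSpace B] (X : MMField.{u, v} B) {ι : Type*} [Countable ι] {G : Set (ι → X.carrier)}
    (hG : MeasurableSet G) {r : ℝ≥0∞} (hr : r < (Measure.infinitePi fun _ : ι => X.measure) G) :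
    ∃ S, MeasurableSet S ∧ S ⊆ X.adm ι '' G ∧ r < X.admLaw ι S := by
  -- The image of a measurable set need not be measurable, but that of a compact set is compact.
  obtain ⟨K, hKG, hK, hrK⟩ := hG.exists_lt_isCompact_of_ne_top (measure_ne_top _ _) hr
  have hS : MeasurableSet (X.adm ι '' K) := (hK.image (X.continuous_adm ι)).measurableSet
  refine ⟨X.adm ι '' K, hS, Set.image_mono hKG, hrK.trans_le ?_⟩
  rw [admLaw, Measure.map_apply (X.measurable_adm ι) hS]
  exact measure_mono (Set.subset_preimage_image _ _)

/-- If the Wasserstein distances of order one between the laws of the finite augmented distance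
matrices are bounded by a number less than `c`, there are samples with augmented distance matrices
of distance at most `c` and with empirical measures close to the measures of the fields. -/
theorem exists_samples [SecondCountableTopology B] [MeasurableSpace B] [BorelSpace B]
    (X : MMField.{u, v} B) (Y : MMField.{u, w} B) {a c : ℝ≥0∞} (hac : a < c) (hc : c ≠ ∞)
    (h : ∀ n, wassersteinDist AugDistMatrix.rho 1 (X.admLaw (Fin n)) (Y.admLaw (Fin n)) < a)
    {V : Set (ProbabilityMeasure X.carrier)} (hV : IsOpen V) (hXV : X.law ∈ V)
    {W : Set (ProbabilityMeasure Y.carrier)} (hW : IsOpen W) (hYW : Y.law ∈ W) :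
    ∃ (n : ℕ) (x : Fin (n + 1) → X.carrier) (y : Fin (n + 1) → Y.carrier),
      empiricalMeasure x ∈ V ∧ empiricalMeasure y ∈ W ∧
      AugDistMatrix.rho (X.adm _ x) (Y.adm _ y) ≤ c := by
  have hc0 : c ≠ 0 := (bot_le.trans_lt hac).ne'
  set η := a / c
  have hη : η < 1 := ENNReal.div_lt_of_lt_mul (by simpa using hac)
  -- Half of the mass left by Markov's inequality, one share for each sample's exceptional event.
  set θ := (1 - η) / 2
  have hθ : 0 < θ := ENNReal.half_pos (tsub_pos_of_lt hη).ne'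
  have hθη : η + (θ + θ) = 1 := by
    rw [ENNReal.add_halves, add_tsub_cancel_of_le hη.le]
  have hθ1 : 1 - θ < 1 := ENNReal.sub_lt_self ENNReal.one_ne_top one_ne_zero hθ.ne'
  obtain ⟨n, hnX, hnY⟩ := (((tendsto_measure_empiricalMeasure_mem X.law hV hXV).eventually
    (lt_mem_nhds hθ1)).and ((tendsto_measure_empiricalMeasure_mem Y.law hW hYW).eventually
    (lt_mem_nhds hθ1))).exists
  -- The coupling below lives on matrices, so the events about samples are replaced by sets of
  -- matrices.
  obtain ⟨S, hS, hSV, hSm⟩ := X.exists_measurableSet_admLaw_gt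
    (hV.preimage continuous_empiricalMeasure).measurableSet hnX
  obtain ⟨T, hT, hTW, hTm⟩ := Y.exists_measurableSet_admLaw_gt
    (hW.preimage continuous_empiricalMeasure).measurableSet hnY
  obtain ⟨γ, hγ, hγc⟩ :=
    exists_coupling_measure_ge_le_div AugDistMatrix.measurable_rho (h (n + 1)) hc hc0
  have := isProbabilityMeasure_of_mem_couplings hγ
  have hSγ : γ (Prod.fst ⁻¹' Sᶜ) < θ := by
    rw [← Measure.map_apply measurable_fst hS.compl, hγ.1, prob_compl_eq_one_sub hS]
    exact ENNReal.sub_lt_of_sub_lt prob_le_one (.inl ENNReal.one_ne_top) hSm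
  have hTγ : γ (Prod.snd ⁻¹' Tᶜ) < θ := by
    rw [← Measure.map_apply measurable_snd hT.compl, hγ.2, prob_compl_eq_one_sub hT]
    exact ENNReal.sub_lt_of_sub_lt prob_le_one (.inl ENNReal.one_ne_top) hTm
  -- The three bad events have total mass less than `η + θ + θ = 1`.
  obtain ⟨z, hz⟩ : ∃ z, z ∉ {z | c ≤ AugDistMatrix.rho z.1 z.2} ∪
      (Prod.fst ⁻¹' Sᶜ ∪ Prod.snd ⁻¹' Tᶜ) := by
    by_contra! hcon
    have hlt := (measure_union_le _ _).trans_lt (ENNReal.add_lt_add_of_le_of_lt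
      (measure_ne_top γ _) hγc ((measure_union_le _ _).trans_lt (ENNReal.add_lt_add hSγ hTγ)))
    rw [Set.eq_univ_of_forall hcon, measure_univ, hθη] at hlt
    exact hlt.false
  simp only [Set.mem_union, not_or, Set.mem_preimage, Set.mem_compl_iff, not_not] at hz
  obtain ⟨hzc, hzS, hzT⟩ := hz
  obtain ⟨x, hx, hxz⟩ := hSV hzS
  obtain ⟨y, hy, hyz⟩ := hTW hzT
  refine ⟨n, x, y, hx, hy, ?_⟩
  rw [hxz, hyz]
  exact (not_le.1 hzc).le

/-- If there are samples with empirical measures arbitrarily close to the measures of the fields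
and with augmented distance matrices of distance at most `c`, a limit of the joint empirical
measures is a coupling of distortion at most `c`. -/
theorem gromovWassersteinTop_le_of_samples (X : MMField.{u, v} B) (Y : MMField.{u, w} B)
    {c : ℝ≥0∞}
    (h : ∀ V, IsOpen V → X.law ∈ V → ∀ W, IsOpen W → Y.law ∈ W →
      ∃ (n : ℕ) (x : Fin (n + 1) → X.carrier) (y : Fin (n + 1) → Y.carrier),
        empiricalMeasure x ∈ V ∧ empiricalMeasure y ∈ W ∧
        AugDistMatrix.rho (X.adm _ x) (Y.adm _ y) ≤ c) :
    X.gromovWassersteinTop Y ≤ c := by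
  obtain ⟨V, hV, hVb⟩ := (nhds_basis_opens X.law).exists_antitone_subbasis
  obtain ⟨W, hW, hWb⟩ := (nhds_basis_opens Y.law).exists_antitone_subbasis
  choose n x y hx hy hxy using fun k =>
    h (V k) (hV k).2 (hV k).1 (W k) (hW k).2 (hW k).1
  let z (k : ℕ) (i : Fin (n k + 1)) : X.carrier × Y.carrier := (x k i, y k i)
  obtain ⟨γ, hγ, hmem⟩ := exists_tendsto_hyperfilter_of_tendsto_marginals
    (γ := fun k => empiricalMeasure (z k)) (μ := X.law) (ν := Y.law)
    (by simp_rw [map_empiricalMeasure _ measurable_fst]; exact hVb.tendsto hx)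
    (by simp_rw [map_empiricalMeasure _ measurable_snd]; exact hWb.tendsto hy)
  -- By the portmanteau theorem, an open set charged by the limit is eventually charged by the
  -- empirical measures, hence contains a sample pair.
  have hopen {U : Set (X.carrier × Y.carrier)} (hU : IsOpen U) {p : X.carrier × Y.carrier}
      (hp : p ∈ (γ : Measure _).support) (hpU : p ∈ U) :
      ∀ᶠ k in (hyperfilter ℕ : Filter ℕ), ∃ i, z k i ∈ U := by
    have h1 : 0 < (γ : Measure _) U :=
      (Measure.mem_support_iff_forall _).1 hp U (hU.mem_nhds hpU)
    have h2 := h1.trans_le (ProbabilityMeasure.le_liminf_measure_open_of_tendsto hγ hU)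
    exact (eventually_lt_of_lt_liminf h2).mono fun k hk =>
      exists_mem_of_empiricalMeasure_pos hU.measurableSet hk
  refine X.gromovWassersteinTop_le_of_mem Y hmem (fun p hp q hq => ?_) fun p hp => ?_
  -- Distortion above `c` is an open condition, so it would pass to two sample pairs of the same
  -- index `k`.
  · by_contra! hlt
    have hcont : Continuous fun r : (X.carrier × Y.carrier) × (X.carrier × Y.carrier) =>
        2⁻¹ * ENNReal.ofReal |dist r.1.1 r.2.1 - dist r.1.2 r.2.2| :=
      (ENNReal.continuous_const_mul (by simp)).comp
        (ENNReal.continuous_ofReal.comp (by fun_prop))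
    obtain ⟨U, U', hU, hU', hpU, hqU, hUU⟩ := isOpen_prod_iff.1 (hcont.isOpen_preimage _ isOpen_Ioi)
      p q (show (p, q) ∈ _ ⁻¹' Set.Ioi c from hlt)
    obtain ⟨k, ⟨i, hi⟩, j, hj⟩ := ((hopen hU hp hpU).and (hopen hU' hq hqU)).exists
    have hlt : (z k i, z k j) ∈ _ ⁻¹' Set.Ioi c := hUU ⟨hi, hj⟩
    exact absurd ((AugDistMatrix.rho_le_iff.1 (hxy k)).1 i j) (not_le.2 hlt)
  · by_contra! hlt
    have hcont : Continuous fun r : X.carrier × Y.carrier =>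
        ENNReal.ofReal (dist (X.proj r.1) (Y.proj r.2)) :=
      ENNReal.continuous_ofReal.comp ((X.lipschitz.continuous.comp continuous_fst).dist
        (Y.lipschitz.continuous.comp continuous_snd))
    obtain ⟨k, i, hi⟩ := (hopen (hcont.isOpen_preimage _ isOpen_Ioi) hp hlt).exists
    exact absurd ((AugDistMatrix.rho_le_iff.1 (hxy k)).2 i) (not_le.2 hi)

theorem gromovWassersteinTop_le_iSup_wassersteinDist [SecondCountableTopology B]
    [MeasurableSpace B] [BorelSpace B] (X : MMField.{u, v} B) (Y : MMField.{u, w} B) {p : ℝ≥0∞}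
    (hp : 1 ≤ p) :
    X.gromovWassersteinTop Y ≤
      ⨆ n : ℕ, wassersteinDist AugDistMatrix.rho p (X.admLaw (Fin n)) (Y.admLaw (Fin n)) := by
  refine le_of_forall_gt_imp_ge_of_dense fun c hc => ?_
  rcases eq_or_ne c ∞ with rfl | hc'
  · exact le_top
  -- The gap between `a` and `c` keeps the mass `1 - a / c` positive.
  obtain ⟨a, ha, hac⟩ := exists_between hc
  refine X.gromovWassersteinTop_le_of_samples Y fun V hV hXV W hW hYW =>
    X.exists_samples Y hac hc' (fun n => ?_) hV hXV hW hYW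
  exact ((wassersteinDist_mono_exponent AugDistMatrix.measurable_rho hp _ _).trans
    (le_iSup (fun n : ℕ => wassersteinDist AugDistMatrix.rho p (X.admLaw (Fin n))
      (Y.admLaw (Fin n))) n)).trans_lt ha

end MMField

theorem theorem5p4 {B : Type u} [MetricSpace B] [CompleteSpace B] [SecondCountableTopology B]
    [MeasurableSpace B] [BorelSpace B]
    (X : MMField.{u, v} B) (Y : MMField.{u, w} B) (hX : X.IsBounded) (hY : Y.IsBounded)
    (p : ℝ≥0∞) (hp : 1 ≤ p) :
    Monotone (fun n : ℕ =>
        wassersteinDist AugDistMatrix.rho p (X.admDistribution n) (Y.admDistribution n)) ∧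
      Tendsto (fun n : ℕ =>
          wassersteinDist AugDistMatrix.rho p (X.admDistribution n) (Y.admDistribution n))
        atTop (𝓝 (wassersteinDist AugDistMatrix.rho p
          X.admDistributionInfty Y.admDistributionInfty)) ∧
      wassersteinDist AugDistMatrix.rho p X.admDistributionInfty Y.admDistributionInfty =
        X.gromovWassersteinTop Y ∧
      X.gromovWassersteinTop Y ≠ ∞ := by
  simp_rw [MMField.admDistribution_eq_admLaw, MMField.admDistributionInfty_eq_admLaw]
  have hmono : Monotone fun n : ℕ =>
      wassersteinDist AugDistMatrix.rho p (X.admLaw (Fin n)) (Y.admLaw (Fin n)) :=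
    fun m n hmn => X.wassersteinDist_admLaw_le Y p (Fin.castLE_injective hmn)
  -- Three inequalities close a cycle: the supremum over `n`, the distance for infinite matrices,
  -- the Gromov-Wasserstein distance, and back to the supremum.
  have hle := iSup_le fun n : ℕ => X.wassersteinDist_admLaw_le Y p (Fin.val_injective (n := n))
  have hGW := X.gromovWassersteinTop_le_iSup_wassersteinDist Y hp
  have hWG := X.wassersteinDist_admLaw_le_gromovWassersteinTop Y p ℕ
  have hlim := tendsto_atTop_iSup hmono
  rw [hle.antisymm (hWG.trans hGW)] at hlim
  exact ⟨hmono, hlim, hWG.antisymm (hGW.trans hle), X.gromovWassersteinTop_ne_top Y hX hY⟩
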